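/- Let $n,m\ge 0$ be integers and let $g_0,g_1,\dots,g_m:\mathbb{R}^n\to\mathbb{R}^n$ be locally Lipschitz; $|\cdot|$ is the Euclidean norm. For $V:\mathbb{R}^n\to\mathbb{R}_{\ge 0}$ and $x\in\mathbb{R}^n$ let $\partial_D V(x)$ be the set of viscosity subgradients of $V$ at $x$, that is, of all $\zeta\in\mathbb{R}^n$ with $$\liminf_{h\to 0,\,h\ne 0}\frac{V(x+h)-V(x)-\zeta\cdot h}{|h|}\ge 0 .$$ For a system $\Sigma:\dot x=F(x,u)$ with states $x\in\mathbb{R}^n$ and inputs $u\in\mathbb{R}^m$, and for $\gamma\ge 0$, let $\mathcal{W}_\infty(\Sigma,\gamma)$ be the set of continuous functions $V:\mathbb{R}^n\to\mathbb{R}_{\ge 0}$ such that every sublevel set $\{x: V(x)\le a\}$, $a>0$, is compact ($V$ is proper), $V(x)=0$ if and only if $x=0$ ($V$ is positive definite), and $$\zeta\cdot F(x,u)\le -|x|^2+\gamma|u|^2\qquad\text{for all } x\ne 0,\ u\in\mathbb{R}^m,\ \zeta\in\partial_D V(x).$$ Let $\mathcal{C}^k_0$ ($k=1$ or $k=\infty$)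 be the set of continuous functions $V:\mathbb{R}^n\to\mathbb{R}_{\ge 0}$ that are of class $C^k$ on $\mathbb{R}^n\setminus\{0\}$. Then, for the input-affine system $$\Sigma:\quad \dot x=g_0(x)+\sum_{i=1}^m u_i\,g_i(x),$$ one has (with $\inf\emptyset=+\infty$) $$\inf\{\gamma\ge 0 : \mathcal{W}_\infty(\Sigma,\gamma)\ne\emptyset\}=\inf\{\gamma\ge 0 : \mathcal{W}_\infty(\Sigma,\gamma)\cap\mathcal{C}^1_0\ne\emptyset\};$$ moreover, if $\mathcal{W}_\infty(\Sigma,\gamma)\ne\emptyset$ for some $\gamma\ge 0$, then $\mathcal{W}_\infty(\Sigma,\gamma')\cap\mathcal{C}^\infty_0\ne\emptyset$ for every $\gamma'>\gamma$. More generally, both conclusions hold for every system $$\Sigma:\quad \dot x=g_0(x)+\sum_{i=1}^m \varphi(u_i)\,g_i(x),$$ where $\varphi(r)=|r|^p$ or $\varphi(r)=\operatorname{sign}(r)\,|r|^p$ (with $\varphi(0)=0$) and $p$ is a real number with $1\le p\le 2$. -/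

import Mathlib

open scoped Topology ContDiff

noncomputable section

namespace Dissipation

/-- `ℝᵏ` with its Euclidean norm and inner product. -/
abbrev Vec (k : ℕ) : Type := EuclideanSpace ℝ (Fin k)

/-- `ζ` is a viscosity subgradient of `V` at `x`:
`liminf_{h → 0, h ≠ 0} (V (x + h) - V x - ζ · h) / |h| ≥ 0`, the lower limit being taken in the
extended reals. -/
def IsViscositySubgradient {n : ℕ} (V : Vec n → ℝ) (x ζ : Vec n) : Prop :=
  0 ≤ Filter.liminf
    (fun h : Vec n => (((V (x + h) - V x - inner ℝ ζ h) / ‖h‖ : ℝ) : EReal)) (𝓝[≠] 0)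

/-- The viscosity subdifferential of `V` at `x` (possibly empty). -/
def viscositySubdifferential {n : ℕ} (V : Vec n → ℝ) (x : Vec n) : Set (Vec n) :=
  {ζ | IsViscositySubgradient V x ζ}

/-- `V` witnesses the gain `γ` for the system `ẋ = F(x, u)` with states in `ℝⁿ` and inputs
in `ℝᵐ`. -/
def WitnessesGain {n m : ℕ} (F : Vec n → Vec m → Vec n) (γ : ℝ) (V : Vec n → ℝ) : Prop :=
  ∀ x : Vec n, x ≠ 0 → ∀ u : Vec m, ∀ ζ ∈ viscositySubdifferential V x,
    inner ℝ ζ (F x u) ≤ -‖x‖ ^ 2 + γ * ‖u‖ ^ 2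

/-- The continuous nonnegative functions that witness the gain `γ`. -/
def storage {n m : ℕ} (F : Vec n → Vec m → Vec n) (γ : ℝ) : Set (Vec n → ℝ) :=
  {V | Continuous V ∧ (∀ x, 0 ≤ V x) ∧ WitnessesGain F γ V}

/-- Proper: every sublevel set `{x | V x ≤ a}`, `a > 0`, is compact. -/
def IsProperFun {n : ℕ} (V : Vec n → ℝ) : Prop :=
  ∀ a : ℝ, 0 < a → IsCompact {x | V x ≤ a}

/-- Positive definite: `V x = 0` exactly at the origin (for functions with values in `[0, ∞)`). -/
def IsPosDefFun {n : ℕ} (V : Vec n → ℝ) : Prop :=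
  ∀ x, V x = 0 ↔ x = 0

/-- The continuous, proper, positive definite functions that witness the gain `γ`. -/
def properStorage {n m : ℕ} (F : Vec n → Vec m → Vec n) (γ : ℝ) : Set (Vec n → ℝ) :=
  {V | V ∈ storage F γ ∧ IsProperFun V ∧ IsPosDefFun V}

/-- Continuous nonnegative functions on `ℝⁿ` that are of class `C^k` on `ℝⁿ \ {0}`. -/
def classOffOrigin (n : ℕ) (k : ℕ∞) : Set (Vec n → ℝ) :=
  {V | Continuous V ∧ (∀ x, 0 ≤ V x) ∧ ContDiffOn ℝ k V {0}ᶜ}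

/-- The infimum of the gains `γ ≥ 0` that satisfy `P`, in the extended reals (`∞` if there is no
such gain). -/
def infGain (P : ℝ → Prop) : EReal :=
  sInf ((fun γ : ℝ => (γ : EReal)) '' {γ | 0 ≤ γ ∧ P γ})

/-- The input-affine system `ẋ = g₀(x) + ∑ᵢ uᵢ gᵢ(x)`. -/
def affineSystem {n m : ℕ} (g₀ : Vec n → Vec n) (g : Fin m → Vec n → Vec n) :
    Vec n → Vec m → Vec n :=
  fun x u => g₀ x + ∑ i, u i • g i x

/-- The system `ẋ = g₀(x) + ∑ᵢ φ(uᵢ) gᵢ(x)`. -/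
def transformedSystem {n m : ℕ} (φ : ℝ → ℝ) (g₀ : Vec n → Vec n) (g : Fin m → Vec n → Vec n) :
    Vec n → Vec m → Vec n :=
  fun x u => g₀ x + ∑ i, φ (u i) • g i x

/-- `r ↦ |r|^p`. -/
def absPow (p : ℝ) : ℝ → ℝ := fun r => |r| ^ p

/-- `r ↦ sign(r) |r|^p`. -/
def signPow (p : ℝ) : ℝ → ℝ := fun r => Real.sign r * |r| ^ p

end Dissipation

end

/-!
An inf-convolution of `V` on a compact set is Lipschitz, and wherever it is differentiable its
gradient at `x` is a viscosity subgradient of `V` at a nearby minimiser `y`. The displacement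
`‖x - y‖` and the penalty `‖x - y‖² / (2ε)` are controlled by the oscillation of `V`, so the
dissipation inequality of `V` passes, with a small error, to almost every `x`; mollification makes
the approximation smooth on compact sets. A partition of unity along the levels of an exhaustion
function glues these approximations on `ℝⁿ \ {0}` with an error as small as we like, because the
derivatives of the weights only multiply differences of the approximations. Inputs are unbounded,
but all terms grow at most quadratically in `u`, so dividing by `1 + ‖u‖²` makes the estimates
uniform in `u`. Finally, multiplying by a constant `c > 1` with `cγ < γ'` absorbs the error: the
decay improves to `-c‖x‖²` and the gain has room up to `γ'`.
-/

namespace Dissipation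

open Set Filter Metric MeasureTheory
open scoped Gradient NNReal

section Subgradients

variable {n : ℕ} {U V : Vec n → ℝ} {x y ζ : Vec n}

theorem isViscositySubgradient_iff :
    IsViscositySubgradient V x ζ ↔
      ∀ ε : ℝ, 0 < ε → ∀ᶠ h in 𝓝 (0 : Vec n), -ε * ‖h‖ ≤ V (x + h) - V x - inner ℝ ζ h := by
  rw [IsViscositySubgradient, le_liminf_iff]
  constructor
  · intro H ε hε
    have h_lt := H ((-ε : ℝ) : EReal) (by exact_mod_cast neg_lt_zero.2 hε)
    rw [eventually_nhdsWithin_iff] at h_lt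
    filter_upwards [h_lt] with h hh
    by_cases h0 : h = 0
    · simp [h0]
    · have := hh h0
      rw [EReal.coe_lt_coe_iff, lt_div_iff₀ (norm_pos_iff.2 h0)] at this
      exact this.le
  · intro H a ha
    obtain ⟨b, hab, hb⟩ := EReal.lt_iff_exists_real_btwn.1 ha
    have hb0 : b < 0 := by exact_mod_cast hb
    rw [eventually_nhdsWithin_iff]
    filter_upwards [H (-b / 2) (by linarith)] with h hh h0
    refine hab.trans ?_
    have hpos : 0 < ‖h‖ := norm_pos_iff.2 h0
    rw [EReal.coe_lt_coe_iff, lt_div_iff₀ hpos]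
    nlinarith

theorem isViscositySubgradient_of_hasGradientAt (hU : HasGradientAt U ζ x)
    (hUV : ∀ᶠ h in 𝓝 0, U (x + h) - U x ≤ V (y + h) - V y) : IsViscositySubgradient V y ζ := by
  refine isViscositySubgradient_iff.2 fun ε hε => ?_
  filter_upwards [hUV, (hasGradientAt_iff_isLittleO_nhds_zero.1 hU).def hε] with h h_le h_diff
  rw [Real.norm_eq_abs] at h_diff
  linarith [neg_le_of_abs_le h_diff]

theorem IsViscositySubgradient.inner_le_fderiv (hζ : IsViscositySubgradient V x ζ)
    (hV : DifferentiableAt ℝ V x) (v : Vec n) : inner ℝ ζ v ≤ fderiv ℝ V x v := by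
  have h_slope := (hV.hasFDerivAt.hasLineDerivAt v).tendsto_slope_zero_right
  have h_ray : Tendsto (fun t : ℝ => t • v) (𝓝[>] 0) (𝓝 0) :=
    ((continuous_id.smul continuous_const).tendsto' 0 0 (zero_smul ℝ v)).mono_left
      nhdsWithin_le_nhds
  have h_lower (ε : ℝ) (hε : 0 < ε) : inner ℝ ζ v - ε * ‖v‖ ≤ fderiv ℝ V x v := by
    refine ge_of_tendsto h_slope ?_
    filter_upwards [h_ray.eventually (isViscositySubgradient_iff.1 hζ ε hε),
      self_mem_nhdsWithin] with t ht ht0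
    have ht0 : 0 < t := ht0
    rw [norm_smul, Real.norm_of_nonneg ht0.le, inner_smul_right] at ht
    rw [smul_eq_mul, le_inv_mul_iff₀ ht0]
    linarith
  have h_lim : Tendsto (fun ε : ℝ => inner ℝ ζ v - ε * ‖v‖) (𝓝[>] 0) (𝓝 (inner ℝ ζ v)) :=
    ((by fun_prop : Continuous fun ε : ℝ => inner ℝ ζ v - ε * ‖v‖).tendsto' 0 _
      (by simp)).mono_left nhdsWithin_le_nhds
  exact le_of_tendsto h_lim (eventually_mem_nhdsWithin.mono h_lower)

end Subgradients

section InfConvolution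

variable {E : Type*} [NormedAddCommGroup E] {V : E → ℝ} {K : Set E} {ε : ℝ} {x y : E}

/-- The inf-convolution of `V`, restricted to `K`, with the quadratic kernel `‖·‖² / (2ε)`. -/
noncomputable def infConvolution (V : E → ℝ) (K : Set E) (ε : ℝ) (x : E) : ℝ :=
  sInf ((fun y => V y + ‖x - y‖ ^ 2 / (2 * ε)) '' K)

theorem infConvolution_le (hK : IsCompact K) (hV : ContinuousOn V K) (hy : y ∈ K) (x : E) :
    infConvolution V K ε x ≤ V y + ‖x - y‖ ^ 2 / (2 * ε) :=
  csInf_le (hK.bddBelow_image (by fun_prop)) (mem_image_of_mem _ hy)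

theorem infConvolution_le_self (hK : IsCompact K) (hV : ContinuousOn V K) (hx : x ∈ K) :
    infConvolution V K ε x ≤ V x := by
  simpa using infConvolution_le (ε := ε) hK hV hx x

theorem exists_infConvolution_eq (hK : IsCompact K) (hne : K.Nonempty) (hV : ContinuousOn V K)
    (x : E) : ∃ y ∈ K, infConvolution V K ε x = V y + ‖x - y‖ ^ 2 / (2 * ε) :=
  hK.exists_sInf_image_eq hne (by fun_prop)

theorem lipschitzOnWith_infConvolution (hK : IsCompact K) (hV : ContinuousOn V K) (hε : 0 < ε) :
    LipschitzOnWith (diam K / ε).toNNReal (infConvolution V K ε) K := by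
  refine LipschitzOnWith.of_le_add_mul _ fun x hx x' hx' => ?_
  rw [Real.coe_toNNReal _ (by positivity), dist_eq_norm]
  obtain ⟨y, hy, hx'y⟩ := exists_infConvolution_eq (ε := ε) hK ⟨x, hx⟩ hV x'
  have h_sq : ‖x - y‖ ^ 2 - ‖x' - y‖ ^ 2 ≤ 2 * diam K * ‖x - x'‖ := by
    have h_xy : ‖x - y‖ ≤ diam K := dist_eq_norm x y ▸ dist_le_diam_of_mem hK.isBounded hx hy
    have h_x'y : ‖x' - y‖ ≤ diam K := dist_eq_norm x' y ▸ dist_le_diam_of_mem hK.isBounded hx' hy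
    have h_tri : ‖x - y‖ ≤ ‖x - x'‖ + ‖x' - y‖ := norm_sub_le_norm_sub_add_norm_sub _ _ _
    nlinarith [norm_nonneg (x - y), norm_nonneg (x' - y), norm_nonneg (x - x')]
  calc infConvolution V K ε x
      ≤ V y + ‖x - y‖ ^ 2 / (2 * ε) := infConvolution_le hK hV hy x
    _ = infConvolution V K ε x' + (‖x - y‖ ^ 2 - ‖x' - y‖ ^ 2) / (2 * ε) := by rw [hx'y]; ring
    _ ≤ infConvolution V K ε x' + 2 * diam K * ‖x - x'‖ / (2 * ε) := by gcongr
    _ = infConvolution V K ε x' + diam K / ε * ‖x - x'‖ := by field_simp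

theorem exists_forall_norm_sub_lt_of_add_sq_le (hK : IsCompact K) (hV : ContinuousOn V K) {d : ℝ}
    (hd : 0 < d) :
    ∃ ε > 0, ∀ x ∈ K, ∀ y ∈ K, V y + ‖x - y‖ ^ 2 / (2 * ε) ≤ V x →
      ‖x - y‖ < d ∧ V x - V y < d := by
  obtain ⟨M, hM⟩ := hK.exists_bound_of_continuousOn hV
  obtain ⟨δ, hδ, hVδ⟩ := Metric.uniformContinuousOn_iff.1
    (hK.uniformContinuousOn_of_continuous hV) d hd
  set r := min d δ
  have hr : 0 < r := by positivity
  refine ⟨r ^ 2 / (4 * (|M| + 1)), by positivity, fun x hx y hy hxy => ?_⟩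
  have h_osc : V x - V y ≤ 2 * |M| := by
    have hx_le := abs_le.1 ((hM x hx).trans (le_abs_self M))
    have hy_le := abs_le.1 ((hM y hy).trans (le_abs_self M))
    linarith
  have h_sq : ‖x - y‖ ^ 2 < r ^ 2 := by
    have h_div : ‖x - y‖ ^ 2 / (2 * (r ^ 2 / (4 * (|M| + 1)))) < 2 * (|M| + 1) := by linarith
    rw [div_lt_iff₀ (by positivity)] at h_div
    exact h_div.trans_eq (by field_simp; ring)
  have h_lt : ‖x - y‖ < r := lt_of_pow_lt_pow_left₀ 2 hr.le h_sq
  exact ⟨h_lt.trans_le (min_le_left _ _), (le_abs_self _).trans_lt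
    (hVδ x hx y hy (dist_eq_norm x y ▸ h_lt.trans_le (min_le_right _ _)))⟩

theorem gradient_infConvolution [InnerProductSpace ℝ E] [CompleteSpace E] (hK : IsCompact K)
    (hV : ContinuousOn V K) (hy : y ∈ K)
    (hxy : infConvolution V K ε x = V y + ‖x - y‖ ^ 2 / (2 * ε))
    (hdiff : DifferentiableAt ℝ (infConvolution V K ε) x) :
    ∇ (infConvolution V K ε) x = ε⁻¹ • (x - y) := by
  have h_quad : HasFDerivAt (fun x' => V y + ‖x' - y‖ ^ 2 / (2 * ε))
      (InnerProductSpace.toDual ℝ E (ε⁻¹ • (x - y))) x := by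
    simp only [div_eq_inv_mul]
    refine (((hasFDerivAt_id x).sub_const y).norm_sq.const_mul (2 * ε)⁻¹).const_add (V y)
      |>.congr_fderiv ?_
    ext v
    simp only [mul_inv_rev, id_eq, map_sub, ContinuousLinearMap.comp_id, smul_apply, sub_apply,
      coe_innerSL_apply, nsmul_eq_mul, Nat.cast_ofNat, smul_eq_mul, map_smul,
      InnerProductSpace.toDual_apply_apply]
    ring
  have h_min : IsLocalMin
      (fun x' => V y + ‖x' - y‖ ^ 2 / (2 * ε) - infConvolution V K ε x') x :=
    Eventually.of_forall fun x' => by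
      simpa only [hxy, sub_self, sub_nonneg] using infConvolution_le hK hV hy x'
  have h_zero := h_min.hasFDerivAt_eq_zero (h_quad.sub hdiff.hasGradientAt.hasFDerivAt)
  exact ((InnerProductSpace.toDual ℝ E).injective (sub_eq_zero.1 h_zero)).symm

end InfConvolution

section DissipationInequality

variable {n : ℕ} {V : Vec n → ℝ} {K : Set (Vec n)} {ε : ℝ} {x y : Vec n}

theorem isViscositySubgradient_gradient_infConvolution (hK : IsCompact K) (hV : ContinuousOn V K)
    (hy : K ∈ 𝓝 y) (hxy : infConvolution V K ε x = V y + ‖x - y‖ ^ 2 / (2 * ε))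
    (hdiff : DifferentiableAt ℝ (infConvolution V K ε) x) :
    IsViscositySubgradient V y (∇ (infConvolution V K ε) x) := by
  refine isViscositySubgradient_of_hasGradientAt hdiff.hasGradientAt ?_
  have h_mem : ∀ᶠ h in 𝓝 (0 : Vec n), y + h ∈ K :=
    (continuous_const_add y).tendsto' 0 y (add_zero y) hy
  filter_upwards [h_mem] with h hh
  have h_le := infConvolution_le (ε := ε) hK hV hh (x + h)
  rw [add_sub_add_right_eq_sub] at h_le
  linarith

/-- The penalty `‖x - y‖² / (2ε)` is at most the oscillation `V x - V y`, so replacing `y` by `x`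
in the dissipation inequality costs a multiple of that oscillation, whatever `ε` is. -/
theorem fderiv_infConvolution_apply_le {f : Vec n → Vec n} {l : Vec n → ℝ} {L : ℝ≥0}
    (hK : IsCompact K) (hV : ContinuousOn V K) (hf : LipschitzOnWith L f K)
    (hl : LipschitzOnWith L l K) (hε : 0 < ε) (hx : x ∈ K) (hy : K ∈ 𝓝 y)
    (hxy : infConvolution V K ε x = V y + ‖x - y‖ ^ 2 / (2 * ε))
    (hdiff : DifferentiableAt ℝ (infConvolution V K ε) x)
    (hdiss : ∀ ζ ∈ viscositySubdifferential V y, inner ℝ ζ (f y) ≤ l y) :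
    fderiv ℝ (infConvolution V K ε) x (f x) ≤ l x + L * (‖x - y‖ + 2 * (V x - V y)) := by
  have hyK := mem_of_mem_nhds hy
  have h_pen : ‖x - y‖ ^ 2 / (2 * ε) ≤ V x - V y := by
    linarith [infConvolution_le_self (ε := ε) hK hV hx]
  have h_grad := gradient_infConvolution hK hV hyK hxy hdiff
  have h_at_y : inner ℝ (∇ (infConvolution V K ε) x) (f y) ≤ l x + L * ‖x - y‖ := by
    have h_l := hl.norm_sub_le hx hyK
    have h_sub := hdiss _ (isViscositySubgradient_gradient_infConvolution hK hV hy hxy hdiff)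
    linarith [neg_le_of_abs_le h_l]
  have h_diff : inner ℝ (∇ (infConvolution V K ε) x) (f x - f y) ≤ L * (2 * (V x - V y)) :=
    calc inner ℝ (∇ (infConvolution V K ε) x) (f x - f y)
        ≤ ‖∇ (infConvolution V K ε) x‖ * ‖f x - f y‖ := real_inner_le_norm _ _
      _ ≤ ε⁻¹ * ‖x - y‖ * (L * ‖x - y‖) := by
          rw [h_grad, norm_smul, Real.norm_of_nonneg (inv_nonneg.2 hε.le)]
          gcongr
          exact hf.norm_sub_le hx hyK
      _ = L * (2 * (‖x - y‖ ^ 2 / (2 * ε))) := by field_simp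
      _ ≤ L * (2 * (V x - V y)) := by gcongr
  rw [← inner_gradient_left, ← sub_add_cancel (f x) (f y), inner_add_right]
  linarith

end DissipationInequality

section UniformlyLipschitz

variable {ι κ E G : Type*} [PseudoMetricSpace E] [NormedAddCommGroup G] {Ω : Set E}
  {f g : ι → E → G}

/-- The family `f` is bounded and Lipschitz on each compact subset of `Ω`, with constants that do
not depend on the index. For a system the index is the input. -/
def UniformlyLipschitzOnCompacts (f : ι → E → G) (Ω : Set E) : Prop :=
  ∀ K ⊆ Ω, IsCompact K → ∃ L : ℝ≥0, ∀ i, LipschitzOnWith L (f i) K ∧ ∀ x ∈ K, ‖f i x‖ ≤ L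

theorem uniformlyLipschitzOnCompacts_const {g : E → G} (hg : LocallyLipschitz g) :
    UniformlyLipschitzOnCompacts (fun _ : ι => g) Ω := fun K _ hK => by
  obtain ⟨L, hL⟩ := hg.locallyLipschitzOn.exists_lipschitzOnWith_of_compact hK
  obtain ⟨M, hM⟩ := hK.exists_bound_of_continuousOn hg.continuous.continuousOn
  exact ⟨max L M.toNNReal, fun _ => ⟨hL.weaken (le_max_left _ _), fun x hx =>
    (hM x hx).trans ((Real.le_coe_toNNReal M).trans (NNReal.coe_le_coe.2 (le_max_right _ _)))⟩⟩

theorem UniformlyLipschitzOnCompacts.add (hf : UniformlyLipschitzOnCompacts f Ω)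
    (hg : UniformlyLipschitzOnCompacts g Ω) :
    UniformlyLipschitzOnCompacts (fun i x => f i x + g i x) Ω := fun K hKΩ hK => by
  obtain ⟨L, hL⟩ := hf K hKΩ hK
  obtain ⟨M, hM⟩ := hg K hKΩ hK
  exact ⟨L + M, fun i => ⟨(hL i).1.add (hM i).1, fun x hx =>
    norm_add_le_of_le ((hL i).2 x hx) ((hM i).2 x hx)⟩⟩

theorem uniformlyLipschitzOnCompacts_sum {s : Finset κ} {f : κ → ι → E → G}
    (hf : ∀ j ∈ s, UniformlyLipschitzOnCompacts (f j) Ω) :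
    UniformlyLipschitzOnCompacts (fun i x => ∑ j ∈ s, f j i x) Ω := by
  induction s using Finset.cons_induction with
  | empty => simpa using uniformlyLipschitzOnCompacts_const (LocallyLipschitz.const (0 : G))
  | cons j s hj ih =>
    simp only [Finset.sum_cons]
    exact (hf j (Finset.mem_cons_self j s)).add
      (ih fun k hk => hf k (Finset.mem_cons_of_mem hk))

theorem uniformlyLipschitzOnCompacts_smul [NormedSpace ℝ G] {g : E → G}
    (hg : LocallyLipschitz g) {a : ι → ℝ} {A : ℝ} (ha : ∀ i, |a i| ≤ A) :
    UniformlyLipschitzOnCompacts (fun i x => a i • g x) Ω := fun K hKΩ hK => by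
  obtain ⟨L, hL⟩ := uniformlyLipschitzOnCompacts_const (ι := ι) hg K hKΩ hK
  have haA (i) : ‖a i‖₊ ≤ A.toNNReal :=
    NNReal.coe_le_coe.1 ((ha i).trans (Real.le_coe_toNNReal A))
  refine ⟨A.toNNReal * L, fun i => ⟨?_, fun x hx => ?_⟩⟩
  · exact ((lipschitzWith_smul (a i)).comp_lipschitzOnWith (hL i).1).weaken
      (mul_le_mul_left (haA i) L)
  · exact (norm_smul_le _ _).trans
      (mul_le_mul (NNReal.coe_le_coe.2 (haA i)) ((hL i).2 x hx) (norm_nonneg _) A.toNNReal.2)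

end UniformlyLipschitz

section LipschitzApproximation

variable {n : ℕ} {ι : Type*} {V : Vec n → ℝ} {K Ω : Set (Vec n)} {f : ι → Vec n → Vec n}
  {l : ι → Vec n → ℝ} {e : ℝ}

/-- `V` dissipates along the vector fields `f i` on `Ω` with rates `l i`, in the viscosity
sense. -/
def ViscosityDissipationOn (V : Vec n → ℝ) (f : ι → Vec n → Vec n) (l : ι → Vec n → ℝ)
    (Ω : Set (Vec n)) : Prop :=
  ∀ x ∈ Ω, ∀ i, ∀ ζ ∈ viscositySubdifferential V x, inner ℝ ζ (f i x) ≤ l i x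

theorem exists_infConvolution_approx {L : ℝ≥0} (hK : IsCompact K) (hV : ContinuousOn V K)
    (hf : ∀ i, LipschitzOnWith L (f i) K) (hl : ∀ i, LipschitzOnWith L (l i) K)
    (hdiss : ViscosityDissipationOn V f l K) {r : ℝ} (hr : 0 < r) (he : 0 < e) :
    ∃ ε > 0, (∀ x ∈ K, |infConvolution V K ε x - V x| ≤ e) ∧
      ∀ x, ball x r ⊆ K → DifferentiableAt ℝ (infConvolution V K ε) x →
        ∀ i, fderiv ℝ (infConvolution V K ε) x (f i x) ≤ l i x + e := by
  set d := min r (e / (3 * L + 1))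
  have hd : 0 < d := by positivity
  have hLd : 3 * L * d + d ≤ e := by
    have hde : d * (3 * L + 1) ≤ e := (le_div_iff₀ (by positivity)).1 (min_le_right _ _)
    linarith
  obtain ⟨ε, hε, h_close⟩ := exists_forall_norm_sub_lt_of_add_sq_le hK hV hd
  have h_argmin (x) (hx : x ∈ K) : ∃ y ∈ K,
      infConvolution V K ε x = V y + ‖x - y‖ ^ 2 / (2 * ε) ∧ ‖x - y‖ < d ∧ V x - V y < d := by
    obtain ⟨y, hy, hxy⟩ := exists_infConvolution_eq (ε := ε) hK ⟨x, hx⟩ hV x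
    exact ⟨y, hy, hxy, h_close x hx y hy (hxy ▸ infConvolution_le_self hK hV hx)⟩
  refine ⟨ε, hε, fun x hx => ?_, fun x hx hdiff i => ?_⟩
  · obtain ⟨y, -, hxy, -, hVxy⟩ := h_argmin x hx
    have h_pen : 0 ≤ ‖x - y‖ ^ 2 / (2 * ε) := by positivity
    have h_Ld : 0 ≤ 3 * L * d := by positivity
    rw [abs_sub_comm, abs_of_nonneg (sub_nonneg.2 (infConvolution_le_self hK hV hx))]
    linarith
  · have hxK := hx (mem_ball_self hr)
    obtain ⟨y, hyK, hxy, h_dist, hVxy⟩ := h_argmin x hxK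
    have hy : K ∈ 𝓝 y := mem_of_superset
      (isOpen_ball.mem_nhds (mem_ball_iff_norm'.2 (h_dist.trans_le (min_le_left _ _)))) hx
    calc fderiv ℝ (infConvolution V K ε) x (f i x)
        ≤ l i x + L * (‖x - y‖ + 2 * (V x - V y)) :=
          fderiv_infConvolution_apply_le hK hV (hf i) (hl i) hε hxK hy hxy hdiff (hdiss y hyK i)
      _ ≤ l i x + L * (d + 2 * d) := by gcongr
      _ ≤ l i x + e := by linarith

theorem exists_lipschitz_approx (hΩ : IsOpen Ω) (hV : ContinuousOn V Ω)
    (hf : UniformlyLipschitzOnCompacts f Ω) (hl : UniformlyLipschitzOnCompacts l Ω)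
    (hdiss : ViscosityDissipationOn V f l Ω) (hK : IsCompact K) (hKΩ : K ⊆ Ω) (he : 0 < e) :
    ∃ (U : Vec n → ℝ) (C : ℝ≥0) (δ : ℝ), LipschitzWith C U ∧ 0 < δ ∧ cthickening δ K ⊆ Ω ∧
      (∀ x ∈ K, |U x - V x| ≤ e) ∧
      ∀ x ∈ thickening δ K, DifferentiableAt ℝ U x → ∀ i, fderiv ℝ U x (f i x) ≤ l i x + e := by
  obtain ⟨δ, hδ, hδΩ⟩ := hK.exists_cthickening_subset_open hΩ hKΩ
  set K₁ := cthickening δ K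
  have hK₁ : IsCompact K₁ := hK.cthickening
  have hVK₁ := hV.mono hδΩ
  obtain ⟨L, hL⟩ := hf K₁ hδΩ hK₁
  obtain ⟨M, hM⟩ := hl K₁ hδΩ hK₁
  obtain ⟨ε, hε, h_near, h_fderiv⟩ := exists_infConvolution_approx hK₁ hVK₁
    (fun i => (hL i).1.weaken (le_max_left L M)) (fun i => (hM i).1.weaken (le_max_right L M))
    (fun x hx => hdiss x (hδΩ hx)) (half_pos hδ) he
  obtain ⟨U, hU, hUeq⟩ := (lipschitzOnWith_infConvolution hK₁ hVK₁ hε).extend_real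
  refine ⟨U, _, δ / 2, hU, half_pos hδ, (cthickening_mono (half_le_self hδ.le) K).trans hδΩ,
    fun x hx => ?_, fun x hx hdiff i => ?_⟩
  · have hxK₁ := self_subset_cthickening (δ := δ) K hx
    rw [← hUeq hxK₁]
    exact h_near x hxK₁
  · obtain ⟨z, hz, hxz⟩ := mem_thickening_iff.1 hx
    have h_ball : ball x (δ / 2) ⊆ K₁ := fun w hw => by
      refine thickening_subset_cthickening δ K (mem_thickening_iff.2 ⟨z, hz, ?_⟩)
      linarith [dist_triangle w x z, mem_ball.1 hw]
    have h_eq : infConvolution V K₁ ε =ᶠ[𝓝 x] U :=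
      hUeq.eventuallyEq_of_mem (mem_of_superset (ball_mem_nhds x (half_pos hδ)) h_ball)
    rw [← h_eq.fderiv_eq]
    exact h_fderiv x h_ball (h_eq.differentiableAt_iff.2 hdiff) i

end LipschitzApproximation

section Mollification

variable {E : Type*} [NormedAddCommGroup E] [NormedSpace ℝ E] [FiniteDimensional ℝ E]
  [MeasurableSpace E] [BorelSpace E] {μ : Measure E} [μ.IsAddHaarMeasure] {C : ℝ≥0}
  {ρ U : E → ℝ}

theorem ae_differentiableAt_const_sub (hU : LipschitzWith C U) (x : E) :
    ∀ᵐ t ∂μ, DifferentiableAt ℝ U (x - t) :=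
  (Measure.measurePreserving_sub_left μ x).quasiMeasurePreserving.ae hU.ae_differentiableAt

theorem hasFDerivAt_convolution_of_lipschitzWith (hU : LipschitzWith C U) (hρ : Continuous ρ)
    (hρc : HasCompactSupport ρ) (x : E) :
    Integrable (fun t => ρ t • fderiv ℝ U (x - t)) μ ∧
      HasFDerivAt (convolution ρ U (ContinuousLinearMap.lsmul ℝ ℝ) μ)
        (∫ t, ρ t • fderiv ℝ U (x - t) ∂μ) x := by
  have h_cont (x' : E) : Continuous fun t => ρ t • U (x' - t) :=
    hρ.smul (hU.continuous.comp (continuous_const.sub continuous_id))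
  refine hasFDerivAt_integral_of_dominated_loc_of_lip
    (F := fun x' t => ρ t • U (x' - t)) (bound := fun t => ‖ρ t‖ * C) univ_mem
    (Eventually.of_forall fun x' => (h_cont x').aestronglyMeasurable)
    ((h_cont x).integrable_of_hasCompactSupport hρc.smul_right) ?_ ?_
    ((hρ.integrable_of_hasCompactSupport hρc).norm.mul_const _) ?_
  · exact hρ.aestronglyMeasurable.smul
      ((measurable_fderiv ℝ U).comp (measurable_const.sub measurable_id)).aestronglyMeasurable
  · refine Eventually.of_forall fun t => LipschitzWith.lipschitzOnWith ?_
    refine LipschitzWith.of_dist_le_mul fun a b => ?_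
    have h_dist := hU.dist_le_mul (a - t) (b - t)
    rw [dist_sub_right] at h_dist
    rw [dist_smul₀, Real.coe_nnabs, abs_of_nonneg (by positivity), mul_assoc]
    gcongr
  · filter_upwards [ae_differentiableAt_const_sub (μ := μ) hU x] with t ht
    exact ((hasFDerivAt_comp_sub t).2 ht.hasFDerivAt).const_smul (ρ t)

theorem fderiv_convolution_normed_apply_le (hU : LipschitzWith C U) (φ : ContDiffBump (0 : E))
    {x v : E} {B : ℝ}
    (hB : ∀ z ∈ ball x φ.rOut, DifferentiableAt ℝ U z → fderiv ℝ U z v ≤ B) :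
    fderiv ℝ (convolution (φ.normed μ) U (ContinuousLinearMap.lsmul ℝ ℝ) μ) x v ≤ B := by
  obtain ⟨h_int, h_deriv⟩ := hasFDerivAt_convolution_of_lipschitzWith (μ := μ) hU
    (φ.continuous_normed (μ := μ)) φ.hasCompactSupport_normed x
  calc fderiv ℝ (convolution (φ.normed μ) U (ContinuousLinearMap.lsmul ℝ ℝ) μ) x v
      = ∫ t, φ.normed μ t * fderiv ℝ U (x - t) v ∂μ := by
        rw [h_deriv.fderiv, ContinuousLinearMap.integral_apply h_int]
        rfl
    _ ≤ ∫ t, φ.normed μ t * B ∂μ := by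
        refine integral_mono_ae (h_int.apply_continuousLinearMap v)
          (φ.integrable_normed.mul_const _) ?_
        filter_upwards [ae_differentiableAt_const_sub (μ := μ) hU x] with t ht
        by_cases h_supp : t ∈ Function.support (φ.normed μ)
        · rw [φ.support_normed_eq, mem_ball_zero_iff] at h_supp
          have h_ball : x - t ∈ ball x φ.rOut := by simpa [mem_ball_iff_norm] using h_supp
          exact mul_le_mul_of_nonneg_left (hB _ h_ball ht) (φ.nonneg_normed t)
        · simp [Function.notMem_support.1 h_supp]
    _ = B := by rw [integral_mul_const, φ.integral_normed, one_mul]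

end Mollification

section SmoothApproximation

theorem fderiv_apply_le_of_lipschitz {E : Type*} [NormedAddCommGroup E] [NormedSpace ℝ E]
    {U l : E → ℝ} {f : E → E} {s : Set E} {C L M : ℝ≥0} {x z : E} {r e : ℝ}
    (hU : LipschitzWith C U) (hf : LipschitzOnWith L f s) (hl : LipschitzOnWith M l s)
    (hx : x ∈ s) (hz : z ∈ s) (hxz : ‖x - z‖ ≤ r) (h : fderiv ℝ U z (f z) ≤ l z + e) :
    fderiv ℝ U z (f x) ≤ l x + e + (C * (L * r) + M * r) := by
  have h_field : fderiv ℝ U z (f x - f z) ≤ C * (L * r) :=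
    calc fderiv ℝ U z (f x - f z) ≤ ‖fderiv ℝ U z‖ * ‖f x - f z‖ :=
          (le_abs_self _).trans ((fderiv ℝ U z).le_opNorm _)
      _ ≤ C * (L * r) := by
          gcongr
          · exact norm_fderiv_le_of_lipschitz ℝ hU
          · exact (hf.norm_sub_le hx hz).trans (by gcongr)
  have h_rate : l z - l x ≤ M * r := by
    have h_mul : M * ‖x - z‖ ≤ M * r := by gcongr
    linarith [neg_le_of_abs_le (hl.norm_sub_le hx hz)]
  rw [← sub_add_cancel (f x) (f z), map_add]
  linarith

variable {n : ℕ} {ι : Type*} {V : Vec n → ℝ} {K Ω : Set (Vec n)} {f : ι → Vec n → Vec n}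
  {l : ι → Vec n → ℝ}

theorem exists_smooth_approx_of_isCompact (hΩ : IsOpen Ω) (hV : ContinuousOn V Ω)
    (hf : UniformlyLipschitzOnCompacts f Ω) (hl : UniformlyLipschitzOnCompacts l Ω)
    (hdiss : ViscosityDissipationOn V f l Ω) (hK : IsCompact K) (hKΩ : K ⊆ Ω) {e : ℝ}
    (he : 0 < e) :
    ∃ W : Vec n → ℝ, ContDiff ℝ ∞ W ∧ (∀ x ∈ K, |W x - V x| ≤ e) ∧
      ∀ x ∈ K, ∀ i, fderiv ℝ W x (f i x) ≤ l i x + e := by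
  obtain ⟨U, C, δ, hU, hδ, hδΩ, h_near, h_fderiv⟩ :=
    exists_lipschitz_approx hΩ hV hf hl hdiss hK hKΩ (half_pos he)
  obtain ⟨L, hL⟩ := hf _ hδΩ hK.cthickening
  obtain ⟨M, hM⟩ := hl _ hδΩ hK.cthickening
  set r := min δ (e / 2 / (C + C * L + M + 1))
  have hr : 0 < r := by positivity
  have hr_le : r * (C + C * L + M + 1) ≤ e / 2 :=
    (le_div_iff₀ (by positivity)).1 (min_le_right _ _)
  have hCr : C * r ≤ e / 2 := by
    have h_rest : 0 ≤ r * (C * L + M + 1) := by positivity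
    linarith
  have hLMr : C * (L * r) + M * r ≤ e / 2 := by
    have h_rest : 0 ≤ r * (C + 1) := by positivity
    linarith
  let φ : ContDiffBump (0 : Vec n) := ⟨r / 2, r, by positivity, by linarith⟩
  refine ⟨convolution (φ.normed volume) U (ContinuousLinearMap.lsmul ℝ ℝ) volume,
    φ.hasCompactSupport_normed.contDiff_convolution_left _ φ.contDiff_normed
      hU.continuous.locallyIntegrable, fun x hx => ?_, fun x hx i =>
    fderiv_convolution_normed_apply_le hU φ fun z hz hdiff => ?_⟩
  · refine (abs_sub_le _ (U x) _).trans ?_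
    have h_conv := φ.dist_normed_convolution_le (μ := volume) (ε := C * r)
      hU.continuous.aestronglyMeasurable fun z hz =>
        (hU.dist_le_mul z x).trans (by gcongr; exact (mem_ball.1 hz).le)
    rw [Real.dist_eq] at h_conv
    linarith [h_near x hx]
  · have hxz : ‖x - z‖ ≤ r := (mem_ball_iff_norm'.1 hz).le
    have hx' := self_subset_cthickening (δ := δ) K hx
    have hz' : z ∈ thickening δ K :=
      mem_thickening_iff.2 ⟨x, hx, hz.trans_le (min_le_left _ _)⟩
    have hz'' := thickening_subset_cthickening δ K hz'
    linarith [fderiv_apply_le_of_lipschitz hU (hL i).1 (hM i).1 hx' hz'' hxz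
      (h_fderiv z hz' hdiff i)]

end SmoothApproximation

section PartitionOfUnity

/-- The `k`-th function of a smooth partition of unity on the line, supported in
`[k - 1, k + 1]`. The sum over `k` telescopes to `1`. -/
noncomputable def bump (k : ℤ) (t : ℝ) : ℝ :=
  Real.smoothTransition (t - k + 1) - Real.smoothTransition (t - k)

theorem bump_nonneg (k : ℤ) (t : ℝ) : 0 ≤ bump k t :=
  sub_nonneg.2 (Real.smoothTransition.monotone (by linarith))

theorem bump_le_one (k : ℤ) (t : ℝ) : bump k t ≤ 1 :=
  (sub_le_self _ (Real.smoothTransition.nonneg _)).trans (Real.smoothTransition.le_one _)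

theorem bump_eq_zero {k : ℤ} {t : ℝ} (h : 1 ≤ |t - k|) : bump k t = 0 := by
  rw [bump, sub_eq_zero]
  rcases le_abs'.1 h with h | h
  · rw [Real.smoothTransition.zero_of_nonpos (by linarith),
      Real.smoothTransition.zero_of_nonpos (by linarith)]
  · rw [Real.smoothTransition.one_of_one_le (by linarith),
      Real.smoothTransition.one_of_one_le (by linarith)]

theorem contDiff_bump (k : ℤ) {m : ℕ∞} : ContDiff ℝ m (bump k) :=
  (Real.smoothTransition.contDiff.comp (by fun_prop)).sub
    (Real.smoothTransition.contDiff.comp (by fun_prop))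

theorem sum_bump {k : ℤ} {t : ℝ} (h : |t - k| < 1) :
    ∑ j ∈ Finset.Icc (k - 1) (k + 1), bump j t = 1 := by
  obtain ⟨h_lo, h_hi⟩ := abs_lt.1 h
  have h_Icc : Finset.Icc (k - 1) (k + 1) = {k - 1, k, k + 1} := by grind
  rw [h_Icc, Finset.sum_insert (by grind), Finset.sum_pair (by grind)]
  simp only [bump]
  push_cast
  rw [Real.smoothTransition.one_of_one_le (x := t - (k - 1) + 1) (by linarith),
    Real.smoothTransition.zero_of_nonpos (x := t - (k + 1)) (by linarith),
    show t - (k - 1) = t - k + 1 by ring, show t - (k + 1) + 1 = t - k by ring]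
  ring

variable {E : Type*} {ρ : E → ℝ} {W : ℤ → E → ℝ}
  {Ω : Set E} {x : E} {k : ℤ}

/-- The functions `W k` blended by the partition of unity along the levels of `ρ`. -/
noncomputable def blend (ρ : E → ℝ) (W : ℤ → E → ℝ) (x : E) : ℝ :=
  ∑ᶠ k, bump k (ρ x) * W k x

theorem blend_eq_sum (h : |ρ x - k| < 1) :
    blend ρ W x = ∑ j ∈ Finset.Icc (k - 1) (k + 1), bump j (ρ x) * W j x := by
  refine finsum_eq_sum_of_support_subset _ fun j hj => ?_
  have hj : |ρ x - j| < 1 := not_le.1 fun hj' => hj (by simp only [bump_eq_zero hj', zero_mul])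
  obtain ⟨h₁, h₂⟩ := abs_lt.1 h
  obtain ⟨h₃, h₄⟩ := abs_lt.1 hj
  have h_lo : k - 2 < j := by exact_mod_cast (by linarith : (k : ℝ) - 2 < j)
  have h_hi : j < k + 2 := by exact_mod_cast (by linarith : (j : ℝ) < k + 2)
  exact Finset.mem_coe.2 (Finset.mem_Icc.2 ⟨by lia, by lia⟩)

theorem abs_blend_sub_le (h : |ρ x - k| < 1) {c r : ℝ}
    (hW : ∀ j ∈ Finset.Icc (k - 1) (k + 1), |W j x - c| ≤ r) : |blend ρ W x - c| ≤ r := by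
  rw [blend_eq_sum h, ← Real.dist_eq]
  exact (convex_closedBall c r).sum_mem (fun j _ => bump_nonneg j _) (sum_bump h) hW

variable [NormedAddCommGroup E] [NormedSpace ℝ E]

theorem contDiffOn_blend {m : ℕ∞} (hΩ : IsOpen Ω) (hρ : ContDiffOn ℝ m ρ Ω)
    (hW : ∀ k, ContDiffOn ℝ m (W k) Ω) : ContDiffOn ℝ m (blend ρ W) Ω := fun x hx => by
  have h : |ρ x - ⌊ρ x⌋| < 1 :=
    Int.abs_sub_lt_one_of_floor_eq_floor (Int.floor_intCast _).symm
  have h_sum : ContDiffOn ℝ m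
      (fun z => ∑ j ∈ Finset.Icc (⌊ρ x⌋ - 1) (⌊ρ x⌋ + 1), bump j (ρ z) * W j z) Ω :=
    ContDiffOn.sum fun j _ => ((contDiff_bump j).comp_contDiffOn hρ).mul (hW j)
  have hΩx := hΩ.mem_nhds hx
  have h_near : ∀ᶠ z in 𝓝 x, |ρ z - ⌊ρ x⌋| < 1 :=
    ((hρ.continuousOn.continuousAt hΩx).sub continuousAt_const).abs.eventually_lt_const h
  exact ((h_sum.contDiffAt hΩx).congr_of_eventuallyEq
    (h_near.mono fun _ hz => blend_eq_sum hz)).contDiffWithinAt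

/-- The constant `c` is arbitrary because the derivatives of the weights sum to zero. -/
theorem hasFDerivAt_sum_mul_of_sum_eq_one {ι : Type*} {s : Finset ι} {ψ W : ι → E → ℝ}
    (hψ : ∀ j ∈ s, DifferentiableAt ℝ (ψ j) x) (hW : ∀ j ∈ s, DifferentiableAt ℝ (W j) x)
    (h_one : ∀ᶠ z in 𝓝 x, ∑ j ∈ s, ψ j z = 1) (c : ℝ) :
    HasFDerivAt (fun z => ∑ j ∈ s, ψ j z * W j z)
      (∑ j ∈ s, (ψ j x • fderiv ℝ (W j) x + (W j x - c) • fderiv ℝ (ψ j) x)) x := by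
  have h_sub : HasFDerivAt (fun z => ∑ j ∈ s, ψ j z * (W j z - c))
      (∑ j ∈ s, (ψ j x • fderiv ℝ (W j) x + (W j x - c) • fderiv ℝ (ψ j) x)) x :=
    HasFDerivAt.fun_sum fun j hj =>
      (hψ j hj).hasFDerivAt.mul ((hW j hj).hasFDerivAt.sub_const c)
  refine (h_sub.add_const c).congr_of_eventuallyEq ?_
  filter_upwards [h_one] with z hz
  simp only [mul_sub, Finset.sum_sub_distrib, ← Finset.sum_mul, hz]
  ring

theorem hasFDerivAt_blend (hρ : DifferentiableAt ℝ ρ x) (hW : ∀ j, DifferentiableAt ℝ (W j) x)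
    (h : |ρ x - k| < 1) (c : ℝ) :
    HasFDerivAt (blend ρ W) (∑ j ∈ Finset.Icc (k - 1) (k + 1),
      (bump j (ρ x) • fderiv ℝ (W j) x + (W j x - c) • fderiv ℝ (bump j ∘ ρ) x)) x := by
  have h_near : ∀ᶠ z in 𝓝 x, |ρ z - k| < 1 :=
    (hρ.continuousAt.sub continuousAt_const).abs.eventually_lt_const h
  refine (hasFDerivAt_sum_mul_of_sum_eq_one
    (fun j _ => ((contDiff_bump j (m := 1)).differentiable one_ne_zero).differentiableAt.comp x hρ)
    (fun j _ => hW j) (h_near.mono fun z => sum_bump) c).congr_of_eventuallyEq ?_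
  exact h_near.mono fun z => blend_eq_sum

theorem exists_contDiffOn_isCompact_sublevel {E : Type*} [NormedAddCommGroup E]
    [InnerProductSpace ℝ E] [FiniteDimensional ℝ E] {Ω : Set E} (hΩ : IsOpen Ω) :
    ∃ ρ : E → ℝ, ContDiffOn ℝ ∞ ρ Ω ∧ ∀ a, IsCompact {x ∈ Ω | ρ x ≤ a} := by
  obtain ⟨w, hw_supp, hw, hw_range⟩ := hΩ.exists_contDiff_support_eq (n := ⊤)
  have hw_pos : ∀ x ∈ Ω, 0 < w x := fun x hx =>
    (hw_range (mem_range_self x)).1.lt_of_ne' (hw_supp ▸ hx : x ∈ Function.support w)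
  refine ⟨fun x => ‖x‖ ^ 2 + (w x)⁻¹, ?_, fun a => ?_⟩
  · exact (contDiff_norm_sq ℝ).contDiffOn.add (hw.contDiffOn.inv fun x hx => (hw_pos x hx).ne')
  have h_eq : {x ∈ Ω | ‖x‖ ^ 2 + (w x)⁻¹ ≤ a} = {x | ‖x‖ ^ 2 * w x + 1 ≤ a * w x} := by
    ext x
    by_cases hx : x ∈ Ω
    · have hx_pos := hw_pos x hx
      simp only [mem_ofPred_eq, hx, true_and]
      rw [← mul_le_mul_iff_left₀ hx_pos, add_mul, inv_mul_cancel₀ hx_pos.ne']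
    · have hx_zero : w x = 0 := Function.notMem_support.1 (hw_supp ▸ hx)
      simp [hx, hx_zero]
  refine isCompact_of_isClosed_isBounded ?_ (isBounded_closedBall (x := 0) (r := √a) |>.subset ?_)
  · rw [h_eq]
    exact isClosed_le (by fun_prop) (by fun_prop)
  · rintro x ⟨hx, hxa⟩
    refine mem_closedBall_zero_iff.2 (Real.le_sqrt_of_sq_le ?_)
    linarith [inv_pos.2 (hw_pos x hx)]

end PartitionOfUnity

section SmoothApproximationOnOpen

variable {n : ℕ} {ι : Type*} {V : Vec n → ℝ} {K Ω : Set (Vec n)} {f : ι → Vec n → Vec n}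
  {l : ι → Vec n → ℝ} {η : Vec n → ℝ}

theorem exists_smooth_approx_mul (hΩ : IsOpen Ω) (hV : ContinuousOn V Ω)
    (hf : UniformlyLipschitzOnCompacts f Ω) (hl : UniformlyLipschitzOnCompacts l Ω)
    (hdiss : ViscosityDissipationOn V f l Ω) (hK : IsCompact K) (hKΩ : K ⊆ Ω)
    {ψ : Vec n → ℝ} (hψ : ContDiffOn ℝ 1 ψ Ω) (hψ_mem : ∀ x ∈ K, ψ x ∈ Icc 0 1) {a : ℝ}
    (ha : 0 < a) :
    ∃ W : Vec n → ℝ, ContDiff ℝ ∞ W ∧ (∀ x ∈ K, |W x - V x| ≤ a) ∧ ∀ x ∈ K, ∀ i,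
      ψ x * fderiv ℝ W x (f i x) + (W x - V x) * fderiv ℝ ψ x (f i x) ≤ ψ x * l i x + a := by
  obtain ⟨L, hL⟩ := hf K hKΩ hK
  obtain ⟨M, hM⟩ := hK.exists_bound_of_continuousOn
    ((hψ.continuousOn_fderiv_of_isOpen hΩ le_rfl).mono hKΩ)
  set e := a / (1 + |M| * L)
  have he : 0 < e := by positivity
  have hea : e + e * (|M| * L) = a := by
    rw [← mul_one_add, div_mul_cancel₀ _ (by positivity)]
  obtain ⟨W, hW, h_near, h_fderiv⟩ :=
    exists_smooth_approx_of_isCompact hΩ hV hf hl hdiss hK hKΩ he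
  refine ⟨W, hW, fun x hx => (h_near x hx).trans ?_, fun x hx i => ?_⟩
  · linarith [(by positivity : 0 ≤ e * (|M| * L))]
  · obtain ⟨hψ0, hψ1⟩ := hψ_mem x hx
    have h_W : ψ x * fderiv ℝ W x (f i x) ≤ ψ x * l i x + e := by
      linarith [mul_le_mul_of_nonneg_left (h_fderiv x hx i) hψ0,
        mul_le_of_le_one_left he.le hψ1]
    have h_ψ : (W x - V x) * fderiv ℝ ψ x (f i x) ≤ e * (|M| * L) := by
      refine (le_abs_self _).trans ?_
      rw [abs_mul]
      exact mul_le_mul (h_near x hx) ((fderiv ℝ ψ x).le_of_opNorm_le_of_le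
        ((hM x hx).trans (le_abs_self M)) ((hL i).2 x hx)) (abs_nonneg _) he.le
    linarith

theorem exists_smooth_approx_bump (hΩ : IsOpen Ω) (hV : ContinuousOn V Ω)
    (hf : UniformlyLipschitzOnCompacts f Ω) (hl : UniformlyLipschitzOnCompacts l Ω)
    (hdiss : ViscosityDissipationOn V f l Ω) (hη : ContinuousOn η Ω)
    (hη_pos : ∀ x ∈ Ω, 0 < η x) {ρ : Vec n → ℝ} (hρ : ContDiffOn ℝ 1 ρ Ω) {a : ℝ}
    (hρa : IsCompact {x ∈ Ω | ρ x ≤ a}) (k : ℤ) :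
    ∃ W : Vec n → ℝ, ContDiff ℝ ∞ W ∧ ∀ x ∈ Ω, ρ x ≤ a → |W x - V x| ≤ η x ∧
      ∀ i, bump k (ρ x) * fderiv ℝ W x (f i x) +
        (W x - V x) * fderiv ℝ (bump k ∘ ρ) x (f i x) ≤ bump k (ρ x) * l i x + η x / 3 := by
  have hKΩ : {x ∈ Ω | ρ x ≤ a} ⊆ Ω := sep_subset _ _
  obtain ⟨b, hb, hbη⟩ :=
    hρa.exists_forall_le' (hη.mono hKΩ) (a := 0) fun x hx => hη_pos x hx.1
  obtain ⟨W, hW, h_near, h_fderiv⟩ := exists_smooth_approx_mul hΩ hV hf hl hdiss hρa hKΩ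
    ((contDiff_bump k).comp_contDiffOn hρ)
    (fun x _ => ⟨bump_nonneg k _, bump_le_one k _⟩) (a := b / 3) (by positivity)
  simp only [Function.comp_apply] at h_fderiv
  refine ⟨W, hW, fun x hx hxa => ⟨?_, fun i => ?_⟩⟩
  · linarith [h_near x ⟨hx, hxa⟩, hbη x ⟨hx, hxa⟩]
  · linarith [h_fderiv x ⟨hx, hxa⟩ i, hbη x ⟨hx, hxa⟩]

theorem exists_smooth_approx_of_isOpen (hΩ : IsOpen Ω) (hV : ContinuousOn V Ω)
    (hf : UniformlyLipschitzOnCompacts f Ω) (hl : UniformlyLipschitzOnCompacts l Ω)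
    (hdiss : ViscosityDissipationOn V f l Ω) (hη : ContinuousOn η Ω)
    (hη_pos : ∀ x ∈ Ω, 0 < η x) :
    ∃ W : Vec n → ℝ, ContDiffOn ℝ ∞ W Ω ∧ (∀ x ∈ Ω, |W x - V x| ≤ η x) ∧
      ∀ x ∈ Ω, ∀ i, fderiv ℝ W x (f i x) ≤ l i x + η x := by
  obtain ⟨ρ, hρ, hρ_compact⟩ := exists_contDiffOn_isCompact_sublevel hΩ
  choose W hW h_layer using fun k : ℤ => exists_smooth_approx_bump hΩ hV hf hl hdiss hη hη_pos
    (hρ.of_le (by simp)) (hρ_compact (k + 2)) k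
  have h_floor (x) : |ρ x - ⌊ρ x⌋| < 1 :=
    Int.abs_sub_lt_one_of_floor_eq_floor (Int.floor_intCast _).symm
  have h_level (x) (j : ℤ) (hj : j ∈ Finset.Icc (⌊ρ x⌋ - 1) (⌊ρ x⌋ + 1)) : ρ x ≤ j + 2 := by
    have hj' : (⌊ρ x⌋ : ℝ) - 1 ≤ j := by exact_mod_cast (Finset.mem_Icc.1 hj).1
    linarith [(abs_lt.1 (h_floor x)).2]
  refine ⟨blend ρ W, contDiffOn_blend hΩ hρ fun k => (hW k).contDiffOn, fun x hx => ?_,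
    fun x hx i => ?_⟩
  · exact abs_blend_sub_le (h_floor x) fun j hj => (h_layer j x hx (h_level x j hj)).1
  · have h_deriv := hasFDerivAt_blend (W := W)
      ((hρ.contDiffAt (hΩ.mem_nhds hx)).differentiableAt (by simp))
      (fun j => (hW j).differentiable (by simp) x) (h_floor x) (V x)
    calc fderiv ℝ (blend ρ W) x (f i x)
        = ∑ j ∈ Finset.Icc (⌊ρ x⌋ - 1) (⌊ρ x⌋ + 1), (bump j (ρ x) * fderiv ℝ (W j) x (f i x) +
            (W j x - V x) * fderiv ℝ (bump j ∘ ρ) x (f i x)) := by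
          rw [h_deriv.fderiv]
          simp
      _ ≤ ∑ j ∈ Finset.Icc (⌊ρ x⌋ - 1) (⌊ρ x⌋ + 1), (bump j (ρ x) * l i x + η x / 3) :=
          Finset.sum_le_sum fun j hj => (h_layer j x hx (h_level x j hj)).2 i
      _ = l i x + η x := by
          rw [Finset.sum_add_distrib, ← Finset.sum_mul, sum_bump (h_floor x), one_mul,
            Finset.sum_const, Int.card_Icc, show (⌊ρ x⌋ + 1 + 1 - (⌊ρ x⌋ - 1)).toNat = 3 by lia,
            nsmul_eq_mul]
          push_cast
          ring

theorem exists_smooth_approx_eqOn_compl (hΩ : IsOpen Ω) (hV : ContinuousOn V Ω)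
    (hf : UniformlyLipschitzOnCompacts f Ω) (hl : UniformlyLipschitzOnCompacts l Ω)
    (hdiss : ViscosityDissipationOn V f l Ω) (hη : ContinuousOn η Ω)
    (hη_pos : ∀ x ∈ Ω, 0 < η x) :
    ∃ W : Vec n → ℝ, EqOn W V Ωᶜ ∧ ContDiffOn ℝ ∞ W Ω ∧ (∀ x ∈ Ω, |W x - V x| ≤ η x) ∧
      ∀ x ∈ Ω, ∀ i, fderiv ℝ W x (f i x) ≤ l i x + η x := by
  classical
  obtain ⟨W, hW, h_near, h_fderiv⟩ :=
    exists_smooth_approx_of_isOpen hΩ hV hf hl hdiss hη hη_pos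
  have h_eq : EqOn (Ω.piecewise W V) W Ω := piecewise_eqOn Ω W V
  refine ⟨Ω.piecewise W V, piecewise_eqOn_compl Ω W V, hW.congr h_eq, fun x hx => ?_,
    fun x hx i => ?_⟩
  · rw [h_eq hx]
    exact h_near x hx
  · rw [(h_eq.eventuallyEq_of_mem (hΩ.mem_nhds hx)).fderiv_eq]
    exact h_fderiv x hx i

end SmoothApproximationOnOpen

section Gain

variable {n m : ℕ} {F : Vec n → Vec m → Vec n} {V W η : Vec n → ℝ} {γ γ' C : ℝ} {Ω : Set (Vec n)}

/-- `F(x, u)` grows at most quadratically in `u`, in norm and in Lipschitz constant, uniformly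
for `x` in a compact subset of `Ω`. The weight `1 + ‖u‖²` is the one that turns the inequality
for the gain into one with bounded rates. -/
def HasQuadraticInputGrowthOn (F : Vec n → Vec m → Vec n) (Ω : Set (Vec n)) : Prop :=
  UniformlyLipschitzOnCompacts (fun u x => (1 + ‖u‖ ^ 2)⁻¹ • F x u) Ω

theorem abs_inv_one_add_norm_sq_le_one (u : Vec m) : |(1 + ‖u‖ ^ 2)⁻¹| ≤ 1 := by
  rw [abs_of_nonneg (by positivity)]
  exact inv_le_one_of_one_le₀ (le_add_of_nonneg_right (by positivity))

theorem uniformlyLipschitzOnCompacts_supplyRate :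
    UniformlyLipschitzOnCompacts
      (fun (u : Vec m) (x : Vec n) => (1 + ‖u‖ ^ 2)⁻¹ * (-‖x‖ ^ 2 + γ * ‖u‖ ^ 2)) Ω := by
  have h_norm : LocallyLipschitz fun x : Vec n => -‖x‖ ^ 2 :=
    (contDiff_norm_sq ℝ).neg.locallyLipschitz
  have h_coeff (u : Vec m) : |γ * ((1 + ‖u‖ ^ 2)⁻¹ * ‖u‖ ^ 2)| ≤ |γ| := by
    rw [abs_mul, abs_of_nonneg (by positivity : 0 ≤ (1 + ‖u‖ ^ 2)⁻¹ * ‖u‖ ^ 2)]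
    refine mul_le_of_le_one_right (abs_nonneg γ) ?_
    rw [inv_mul_le_one₀ (by positivity)]
    linarith
  convert (uniformlyLipschitzOnCompacts_smul h_norm abs_inv_one_add_norm_sq_le_one).add
    (uniformlyLipschitzOnCompacts_smul (LocallyLipschitz.const (1 : ℝ)) h_coeff) using 3
  simp only [smul_eq_mul]
  ring

theorem WitnessesGain.exists_smooth_approx (hF : HasQuadraticInputGrowthOn F {0}ᶜ)
    (hV : ContinuousOn V {0}ᶜ) (hVγ : WitnessesGain F γ V) (hη : ContinuousOn η {0}ᶜ)
    (hη_pos : ∀ x ≠ 0, 0 < η x) :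
    ∃ W : Vec n → ℝ, W 0 = V 0 ∧ ContDiffOn ℝ ∞ W {0}ᶜ ∧ (∀ x ≠ 0, |W x - V x| ≤ η x) ∧
      ∀ x ≠ 0, ∀ u,
        fderiv ℝ W x (F x u) ≤ -‖x‖ ^ 2 + γ * ‖u‖ ^ 2 + η x * (1 + ‖u‖ ^ 2) := by
  have hdiss : ViscosityDissipationOn V (fun u x => (1 + ‖u‖ ^ 2)⁻¹ • F x u)
      (fun u x => (1 + ‖u‖ ^ 2)⁻¹ * (-‖x‖ ^ 2 + γ * ‖u‖ ^ 2)) {0}ᶜ := fun x hx u ζ hζ => by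
    rw [inner_smul_right]
    exact mul_le_mul_of_nonneg_left (hVγ x hx u ζ hζ) (by positivity)
  obtain ⟨W, hW₀, hW, h_near, h_fderiv⟩ := exists_smooth_approx_eqOn_compl isOpen_compl_singleton
    hV hF uniformlyLipschitzOnCompacts_supplyRate hdiss hη hη_pos
  refine ⟨W, hW₀ (by simp), hW, h_near, fun x hx u => ?_⟩
  have h := h_fderiv x hx u
  have h_pos : 0 < 1 + ‖u‖ ^ 2 := by positivity
  rw [map_smul, smul_eq_mul, inv_mul_le_iff₀ h_pos, mul_add, mul_inv_cancel_left₀ h_pos.ne'] at h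
  linarith

theorem continuous_of_abs_sub_le (hΩ : IsOpen Ω) (hV : Continuous V) (hη : Continuous η)
    (hη_zero : ∀ x ∉ Ω, η x = 0) (hW : ContinuousOn W Ω) (hWV : ∀ x, |W x - V x| ≤ η x) :
    Continuous W := by
  refine continuous_iff_continuousAt.2 fun x => ?_
  by_cases hx : x ∈ Ω
  · exact hW.continuousAt (hΩ.mem_nhds hx)
  · have h_eq : W x = V x := by
      simpa [hη_zero x hx, sub_eq_zero] using hWV x
    rw [ContinuousAt, h_eq]
    refine (hV.tendsto x).congr_dist (squeeze_zero (fun _ => dist_nonneg) (fun z => ?_)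
      (hη_zero x hx ▸ hη.tendsto x))
    rw [dist_comm, Real.dist_eq]
    exact hWV z

theorem IsProperFun.of_le_mul (hV : IsProperFun V) (hW : Continuous W) (hC : 0 < C)
    (h : ∀ x, V x ≤ C * W x) : IsProperFun W := fun a ha =>
  (hV (C * a) (by positivity)).of_isClosed_subset (isClosed_le hW continuous_const)
    fun x (hx : W x ≤ a) => (h x).trans (by gcongr)

theorem IsPosDefFun.of_le_mul (hV : IsPosDefFun V) (hV_nonneg : ∀ x, 0 ≤ V x) {C' : ℝ}
    (hC : 0 < C) (hVW : ∀ x, V x ≤ C * W x) (hWV : ∀ x, W x ≤ C' * V x) : IsPosDefFun W := by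
  refine fun x => ⟨fun hx => (hV x).1 (le_antisymm ?_ (hV_nonneg x)), fun hx => le_antisymm ?_ ?_⟩
  · simpa only [hx, mul_zero] using hVW x
  · simpa only [(hV x).2 hx, mul_zero] using hWV x
  · exact (mul_nonneg_iff_of_pos_left hC).1 ((hV_nonneg x).trans (hVW x))

theorem witnessesGain_const_mul {c : ℝ} (hc : 0 ≤ c) (hW : ∀ x ≠ 0, DifferentiableAt ℝ W x)
    (h_fderiv : ∀ x ≠ 0, ∀ u,
      fderiv ℝ W x (F x u) ≤ -‖x‖ ^ 2 + γ * ‖u‖ ^ 2 + η x * (1 + ‖u‖ ^ 2))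
    (hηx : ∀ x, c * η x ≤ (c - 1) * ‖x‖ ^ 2) (hηγ : ∀ x, c * η x ≤ γ' - c * γ) :
    WitnessesGain F γ' fun x => c * W x := by
  intro x hx u ζ hζ
  have h_subgrad : IsViscositySubgradient (fun x => c * W x) x ζ := hζ
  have h_deriv := (hW x hx).hasFDerivAt.const_mul c
  have h_absorb := mul_le_mul_of_nonneg_right (hηγ x) (sq_nonneg ‖u‖)
  calc inner ℝ ζ (F x u)
      ≤ fderiv ℝ (fun x => c * W x) x (F x u) :=
        h_subgrad.inner_le_fderiv h_deriv.differentiableAt (F x u)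
    _ = c * fderiv ℝ W x (F x u) := by
        rw [h_deriv.fderiv, FunLike.coe_smul, Pi.smul_apply, smul_eq_mul]
    _ ≤ c * (-‖x‖ ^ 2 + γ * ‖u‖ ^ 2 + η x * (1 + ‖u‖ ^ 2)) :=
        mul_le_mul_of_nonneg_left (h_fderiv x hx u) hc
    _ ≤ -‖x‖ ^ 2 + γ' * ‖u‖ ^ 2 := by linarith [hηx x]

theorem exists_one_lt_mul_lt (h : γ < γ') : ∃ c > 1, c * γ < γ' := by
  have h_near : ∀ᶠ c in 𝓝 (1 : ℝ), c * γ < γ' :=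
    (continuous_mul_const γ).continuousAt.eventually_lt_const (by simpa using h)
  have h_gt : ∀ᶠ c in 𝓝[>] (1 : ℝ), 1 < c := self_mem_nhdsWithin
  exact (h_gt.and (h_near.filter_mono nhdsWithin_le_nhds)).exists

theorem exists_continuous_error {c a : ℝ} (hc : 1 < c) (ha : 0 < a) (hV : Continuous V)
    (hV_pos : ∀ x ≠ 0, 0 < V x) :
    ∃ η : Vec n → ℝ, Continuous η ∧ (∀ x ≠ 0, 0 < η x) ∧
      (∀ x, c * η x ≤ (c - 1) * ‖x‖ ^ 2) ∧ (∀ x, c * η x ≤ a) ∧ ∀ x, η x ≤ V x / 2 := by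
  have hc0 : 0 < c := one_pos.trans hc
  set η : Vec n → ℝ := fun x => min (c⁻¹ * min ((c - 1) * ‖x‖ ^ 2) a) (V x / 2)
  have hcη (x) : c * η x ≤ min ((c - 1) * ‖x‖ ^ 2) a :=
    (le_inv_mul_iff₀ hc0).1 (min_le_left _ _)
  have hη_pos (x) (hx : x ≠ 0) : 0 < η x :=
    lt_min (mul_pos (inv_pos.2 hc0) (lt_min (mul_pos (sub_pos.2 hc)
      (pow_pos (norm_pos_iff.2 hx) 2)) ha)) (half_pos (hV_pos x hx))
  exact ⟨η, by fun_prop, hη_pos, fun x => (hcη x).trans (min_le_left _ _),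
    fun x => (hcη x).trans (min_le_right _ _), fun x => min_le_right _ _⟩

theorem properStorage_inter_classOffOrigin_nonempty_of_lt
    (hF : HasQuadraticInputGrowthOn F {0}ᶜ) (hγ : γ < γ') (h : (properStorage F γ).Nonempty) :
    (properStorage F γ' ∩ classOffOrigin n (⊤ : ℕ∞)).Nonempty := by
  obtain ⟨V, ⟨hV, hV_nonneg, hVγ⟩, hV_proper, hV_posDef⟩ := h
  obtain ⟨c, hc, hcγ⟩ := exists_one_lt_mul_lt hγ
  have hc0 : 0 < c := one_pos.trans hc
  obtain ⟨η, hη, hη_pos, hηx, hηγ, hηV⟩ := exists_continuous_error hc (sub_pos.2 hcγ) hV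
    fun x hx => (hV_nonneg x).lt_of_ne' (mt (hV_posDef x).1 hx)
  obtain ⟨W, hW₀, hW_smooth, h_near, h_fderiv⟩ :=
    hVγ.exists_smooth_approx hF hV.continuousOn hη.continuousOn hη_pos
  have hV₀ : V 0 = 0 := (hV_posDef 0).2 rfl
  have hWV (x) : |W x - V x| ≤ V x / 2 := by
    rcases eq_or_ne x 0 with rfl | hx
    · simp [hW₀, hV₀]
    · exact (h_near x hx).trans (hηV x)
  have hW : Continuous W := continuous_of_abs_sub_le isOpen_compl_singleton hV
    (hV.div_const 2) (by simp [hV₀]) hW_smooth.continuousOn hWV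
  have hV_le (x) : V x ≤ 2 / c * (c * W x) := by
    rw [← mul_assoc, div_mul_cancel₀ _ hc0.ne']
    linarith [(abs_le.1 (hWV x)).1]
  have hle_V (x) : c * W x ≤ 2 * c * V x := by
    nlinarith [(abs_le.1 (hWV x)).2, hV_nonneg x]
  have hcW : Continuous fun x => c * W x := hW.const_mul c
  have hcW_nonneg (x) : 0 ≤ c * W x :=
    (mul_nonneg_iff_of_pos_left (by positivity)).1 ((hV_nonneg x).trans (hV_le x))
  refine ⟨fun x => c * W x, ⟨⟨hcW, hcW_nonneg, ?_⟩, ?_, ?_⟩, hcW, hcW_nonneg,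
    contDiffOn_const.mul hW_smooth⟩
  · exact witnessesGain_const_mul hc0.le
      (fun x hx => (hW_smooth.contDiffAt (isOpen_compl_singleton.mem_nhds hx)).differentiableAt
        (by simp)) h_fderiv hηx hηγ
  · exact hV_proper.of_le_mul hcW (by positivity) hV_le
  · exact hV_posDef.of_le_mul hV_nonneg (by positivity) hV_le hle_V

theorem infGain_eq_of_forall_lt {P Q : ℝ → Prop} (hQP : ∀ γ, Q γ → P γ)
    (hPQ : ∀ γ γ', 0 ≤ γ → γ < γ' → P γ → Q γ') : infGain P = infGain Q := by
  refine le_antisymm (sInf_le_sInf (image_mono fun γ hγ => ⟨hγ.1, hQP γ hγ.2⟩)) (le_sInf ?_)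
  rintro _ ⟨γ, ⟨hγ0, hγP⟩, rfl⟩
  refine EReal.le_of_forall_lt_iff_le.1 fun γ' hγ' => sInf_le (mem_image_of_mem _ ?_)
  have hγγ' := EReal.coe_lt_coe_iff.1 hγ'
  exact ⟨hγ0.trans hγγ'.le, hPQ γ γ' hγ0 hγγ' hγP⟩

end Gain

section InputGrowth

variable {n m : ℕ} {φ : ℝ → ℝ} {g₀ : Vec n → Vec n} {g : Fin m → Vec n → Vec n} {C p : ℝ}
  {Ω : Set (Vec n)}

theorem hasQuadraticInputGrowthOn_transformedSystem (hφ : ∀ r, |φ r| ≤ C * (1 + r ^ 2))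
    (hg₀ : LocallyLipschitz g₀) (hg : ∀ i, LocallyLipschitz (g i)) :
    HasQuadraticInputGrowthOn (transformedSystem φ g₀ g) Ω := by
  have hC : 0 ≤ C := by simpa using (abs_nonneg _).trans (hφ 0)
  have h_coeff (i : Fin m) (u : Vec m) : |(1 + ‖u‖ ^ 2)⁻¹ * φ (u i)| ≤ C := by
    rw [abs_mul, abs_of_nonneg (by positivity : 0 ≤ (1 + ‖u‖ ^ 2)⁻¹),
      inv_mul_le_iff₀ (by positivity), mul_comm]
    refine (hφ (u i)).trans ?_
    gcongr C * (1 + ?_)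
    exact sq_le_sq.2 (by simpa using PiLp.norm_apply_le u i)
  simp only [HasQuadraticInputGrowthOn, transformedSystem, smul_add, Finset.smul_sum, smul_smul]
  exact (uniformlyLipschitzOnCompacts_smul hg₀ abs_inv_one_add_norm_sq_le_one).add
    (uniformlyLipschitzOnCompacts_sum fun i _ =>
      uniformlyLipschitzOnCompacts_smul (hg i) (h_coeff i))

theorem abs_rpow_le_one_add_sq (hp₀ : 0 ≤ p) (hp₂ : p ≤ 2) (r : ℝ) : |r| ^ p ≤ 1 + r ^ 2 := by
  rcases le_total |r| 1 with h | h
  · linarith [Real.rpow_le_one (abs_nonneg r) h hp₀, sq_nonneg r]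
  · have h_mono := Real.rpow_le_rpow_of_exponent_le h hp₂
    rw [Real.rpow_two, sq_abs] at h_mono
    linarith

theorem abs_le_one_add_sq_of_eq_absPow_or_signPow (hp₀ : 0 ≤ p) (hp₂ : p ≤ 2)
    (hφ : φ = absPow p ∨ φ = signPow p) (r : ℝ) : |φ r| ≤ 1 * (1 + r ^ 2) := by
  rw [one_mul]
  refine le_trans ?_ (abs_rpow_le_one_add_sq hp₀ hp₂ r)
  have h_nonneg : 0 ≤ |r| ^ p := by positivity
  rcases hφ with rfl | rfl
  · rw [absPow, abs_of_nonneg h_nonneg]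
  · rw [signPow, abs_mul, abs_of_nonneg h_nonneg]
    refine mul_le_of_le_one_left h_nonneg ?_
    rcases Real.sign_apply_eq r with h | h | h <;> simp [h]

theorem hasQuadraticInputGrowthOn_affineSystem (hg₀ : LocallyLipschitz g₀)
    (hg : ∀ i, LocallyLipschitz (g i)) : HasQuadraticInputGrowthOn (affineSystem g₀ g) Ω :=
  hasQuadraticInputGrowthOn_transformedSystem (φ := id) (C := 1)
    (fun r => by simpa using abs_rpow_le_one_add_sq zero_le_one one_le_two r) hg₀ hg

end InputGrowth

end Dissipation

theorem theorem1_general {n m : ℕ}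
    {F : Dissipation.Vec n → Dissipation.Vec m → Dissipation.Vec n}
    (hF : Dissipation.HasQuadraticInputGrowthOn F {0}ᶜ) :
    Dissipation.infGain (fun γ => (Dissipation.properStorage F γ).Nonempty) =
        Dissipation.infGain (fun γ => (Dissipation.properStorage F γ ∩
          Dissipation.classOffOrigin n 1).Nonempty) ∧
      ∀ γ γ' : ℝ, γ < γ' → (Dissipation.properStorage F γ).Nonempty →
        (Dissipation.properStorage F γ' ∩ Dissipation.classOffOrigin n (⊤ : ℕ∞)).Nonempty := by
  have h_smooth (γ γ' : ℝ) (hγ : γ < γ') (h : (Dissipation.properStorage F γ).Nonempty) :=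
    Dissipation.properStorage_inter_classOffOrigin_nonempty_of_lt hF hγ h
  refine ⟨Dissipation.infGain_eq_of_forall_lt (fun γ h => h.mono Set.inter_subset_left)
    fun γ γ' _ hγ h => ?_, h_smooth⟩
  obtain ⟨V, hV, hV_cont, hV_nonneg, hV_smooth⟩ := h_smooth γ γ' hγ h
  exact ⟨V, hV, hV_cont, hV_nonneg, hV_smooth.of_le (by exact_mod_cast le_top)⟩

theorem theorem1 (n m : ℕ)
    (g₀ : Dissipation.Vec n → Dissipation.Vec n)
    (g : Fin m → Dissipation.Vec n → Dissipation.Vec n)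
    (hg₀ : LocallyLipschitz g₀) (hg : ∀ i, LocallyLipschitz (g i)) :
    -- input-affine systems
    (Dissipation.infGain
          (fun γ => (Dissipation.properStorage (Dissipation.affineSystem g₀ g) γ).Nonempty) =
        Dissipation.infGain
          (fun γ => (Dissipation.properStorage (Dissipation.affineSystem g₀ g) γ ∩
            Dissipation.classOffOrigin n 1).Nonempty) ∧
      ∀ γ γ' : ℝ, 0 ≤ γ → γ < γ' →
        (Dissipation.properStorage (Dissipation.affineSystem g₀ g) γ).Nonempty →
        (Dissipation.properStorage (Dissipation.affineSystem g₀ g) γ' ∩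
          Dissipation.classOffOrigin n (⊤ : ℕ∞)).Nonempty) ∧
    -- systems with powers of the inputs
    (∀ p : ℝ, 1 ≤ p → p ≤ 2 → ∀ φ : ℝ → ℝ,
      φ = Dissipation.absPow p ∨ φ = Dissipation.signPow p →
      (Dissipation.infGain
          (fun γ => (Dissipation.properStorage
            (Dissipation.transformedSystem φ g₀ g) γ).Nonempty) =
        Dissipation.infGain
          (fun γ => (Dissipation.properStorage (Dissipation.transformedSystem φ g₀ g) γ ∩
            Dissipation.classOffOrigin n 1).Nonempty) ∧
      ∀ γ γ' : ℝ, 0 ≤ γ → γ < γ' →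
        (Dissipation.properStorage (Dissipation.transformedSystem φ g₀ g) γ).Nonempty →
        (Dissipation.properStorage (Dissipation.transformedSystem φ g₀ g) γ' ∩
          Dissipation.classOffOrigin n (⊤ : ℕ∞)).Nonempty)) := by
  refine ⟨(theorem1_general
    (Dissipation.hasQuadraticInputGrowthOn_affineSystem hg₀ hg)).imp_right fun h γ γ' _ => h γ γ',
    fun p hp₁ hp₂ φ hφ => ?_⟩
  have h_growth := Dissipation.abs_le_one_add_sq_of_eq_absPow_or_signPow (by linarith) hp₂ hφ
  exact (theorem1_general (Dissipation.hasQuadraticInputGrowthOn_transformedSystem h_growth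
    hg₀ hg)).imp_right fun h γ γ' _ => h γ γ'
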